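/- Setting. Let $Z$ be a real Banach manifold with a smooth involutive diffeomorphism $z\mapsto z^{-*}$, let $\Pi\colon D\to Z$ be a smooth vector bundle whose typical fiber is a complex Banach space $\mathcal E$, with fibers $D_s$ ($s\in Z$), and let $\{(\cdot\mid\cdot)_{z,z^{-*}}\}_{z\in Z}$ be a like-Hermitian structure on $\Pi$. That is: (a) each $(\cdot\mid\cdot)_{z,z^{-*}}\colon D_z\times D_{z^{-*}}\to\mathbb C$ is continuous, linear in the first and antilinear in the second variable, and $\xi\mapsto(\xi\mid\cdot)_{z,z^{-*}}$ and $\eta\mapsto(\cdot\mid\eta)_{z,z^{-*}}$ are topological isomorphisms of $D_z$ onto the space of continuous antilinear functionals on $D_{z^{-*}}$ and (antilinearly) of $D_{z^{-*}}$ onto the dual of $D_z$; (b) $\overline{(\xi\mid\eta)}_{z,z^{-*}}=(\eta\mid\xi)_{z^{-*},z}$; (c) for all trivializations $\Psi_V\colon V\times\mathcal E\to\Pi^{-1}(V)$ and $\Psi_{V^{-*}}\colon V^{-*}\times\mathcal E\to\Pi^{-1}(V^{-*})$ of the bundle over an open set $V\subseteq Z$ and over $V^{-*}=\{z^{-*}\mid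 z\in V\}$, the function $(z,x,y)\mapsto(\Psi_V(z,x)\mid\Psi_{V^{-*}}(z^{-*},y))_{z,z^{-*}}$ is smooth on $V\times\mathcal E\times\mathcal E$. Let $K$ be a reproducing $(-*)$-kernel on $\Pi$, i.e. a family of bounded linear operators $K(s,t)\colon D_t\to D_s$ ($s,t\in Z$) such that $\sum_{j,l=1}^n(K(t_l,t_j^{-*})\eta_j\mid\eta_l)_{t_l,t_l^{-*}}\ge 0$ for all $n\ge1$, $t_j\in Z$ and $\eta_j\in D_{t_j^{-*}}$. For $\xi\in D_s$ let $K_\xi=K(\cdot,s)\xi$, a section of $\Pi$, and let $\mathcal H^K$ be the completion of $\mathcal H^K_0=\operatorname{span}\{K_\xi\mid\xi\in D\}$ with respect to the scalar product determined by $(K_\eta\mid K_\xi)=(K(s^{-*},t)\eta\mid\xi)_{s^{-*},s}$ for $\xi\in D_s$, $\eta\in D_t$. Put $\widehat K\colon D\to\mathcal H^K$, $\widehat K(\xi)=K_\xi$, and $\zeta_K(s)=\overline{\widehat K(D_s)}$ for $s\in Z$. Let $\mathrm{Gr}(\mathcal H^K)$ be the Grassmannian of all closed linear subspaces of $\mathcal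 H^K$ with its manifold topology, i.e. the topology given by the operator norm distance $\|p_{\mathcal S}-p_{\mathcal S'}\|$ of the orthogonal projections. A map $F\colon Z\to\mathrm{Gr}(\mathcal H^K)$ is called locally similar-valued if every point of $Z$ has a neighborhood $V$ such that for all $s,t\in V$ there is an invertible bounded linear operator $T$ on $\mathcal H^K$ with $T(F(s))=F(t)$. Theorem. Suppose that 1. $K$ is continuous as a section of the Banach vector bundle over $Z\times Z$ whose fiber at $(s,t)$ is $\mathcal B(D_t,D_s)$ (equivalently, $K$ read in local trivializations of $\Pi$ is a continuous map into $\mathcal B(\mathcal E)$ with the operator norm), and 2. for every $s\in Z$ the operator $\widehat K|_{D_s}\colon D_s\to\mathcal H^K$ is injective with closed range. Then $\zeta_K\colon Z\to\mathrm{Gr}(\mathcal H^K)$ is continuous if and only if it is locally similar-valued. -/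

import Mathlib

open Bundle Topology
open scoped Manifold ContDiff ComplexConjugate ComplexOrder

noncomputable section

/-! ### Smooth complex vector bundles over a real Banach manifold

A smooth vector bundle over a real manifold `Z` whose typical fiber is a complex Banach space `E` is
given by Mathlib's `FiberBundle E D` together with `VectorBundle ℂ E D` (the trivializations in the
atlas are fiberwise complex linear) and `ContMDiffVectorBundle ∞ E D 𝓘(ℝ, B)` (the transition
functions are real smooth).  The latter is phrased over `ℝ`, so that the underlying real vector
bundle is needed first. -/

/-- The real vector bundle underlying a complex one. -/
instance VectorBundle.complexToReal {Z E : Type*} [TopologicalSpace Z]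
    [NormedAddCommGroup E] [NormedSpace ℂ E]
    (D : Z → Type*) [∀ z, AddCommGroup (D z)] [∀ z, Module ℂ (D z)] [∀ z, TopologicalSpace (D z)]
    [TopologicalSpace (TotalSpace E D)] [FiberBundle E D] [VectorBundle ℂ E D] :
    VectorBundle ℝ E D := by
  have hlin : ∀ (e : Trivialization E (π E D)) [MemTrivializationAtlas e], e.IsLinear ℝ := by
    intro e _
    refine ⟨fun b hb => ⟨(e.linear ℂ hb).map_add, fun c x => ?_⟩⟩
    have h := (e.linear ℂ hb).map_smul (c : ℂ) x
    simpa using h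
  refine ⟨hlin, fun e e' _ _ => ?_⟩
  have := hlin e
  have := hlin e'
  have h := (ContinuousLinearMap.restrictScalarsL ℂ E E ℝ ℝ).continuous.comp_continuousOn
    (continuousOn_coordChange ℂ e e')
  refine h.congr fun b hb => ?_
  ext x
  simp [Trivialization.coordChangeL_apply _ _ hb]

/-! ### Like-Hermitian structures -/

section LikeHermitian

variable {Z : Type*} (B E : Type*) (D : Z → Type*)
  [NormedAddCommGroup B] [NormedSpace ℝ B] [TopologicalSpace Z] [ChartedSpace B Z]
  [NormedAddCommGroup E] [NormedSpace ℂ E]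
  [∀ z, AddCommGroup (D z)] [∀ z, Module ℂ (D z)] [∀ z, TopologicalSpace (D z)]
  [TopologicalSpace (TotalSpace E D)] [FiberBundle E D]

/-- A like-Hermitian structure on the smooth vector bundle `D` over the real Banach manifold `Z`
(modelled on `B`, with typical fiber the complex Banach space `E`), together with the underlying
involutive diffeomorphism `z ↦ z^{-*}` of `Z`, here called `inv`.

To avoid transports along `inv (inv z) = z`, the pairing `(· ∣ ·)_{z, z^{-*}}` is indexed by all
pairs `z`, `w` with `inv z = w`. -/
structure LikeHermitianStructure where
  /-- the involutive diffeomorphism `z ↦ z^{-*}` -/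
  inv : Z ≃ₘ⟮𝓘(ℝ, B), 𝓘(ℝ, B)⟯ Z
  inv_inv : ∀ z, inv (inv z) = z
  /-- the pairing, linear in the first variable and antilinear in the second one -/
  pair : ∀ {z w : Z}, inv z = w → D z →ₗ[ℂ] D w →ₛₗ[starRingEnd ℂ] ℂ
  continuous_pair : ∀ {z w : Z} (h : inv z = w),
    Continuous fun p : D z × D w => pair h p.1 p.2
  /-- strong duality in the first variable: `ξ ↦ (ξ ∣ ·)` is an isomorphism from `D z` onto the
  space of continuous antilinear functionals on `D w` -/
  duality_left : ∀ {z w : Z} (h : inv z = w),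
    ∃ Φ : D z ≃L[ℂ] (D w →SL[starRingEnd ℂ] ℂ), ∀ ξ η, Φ ξ η = pair h ξ η
  /-- strong duality in the second variable: `η ↦ (· ∣ η)` is an antilinear isomorphism from `D w`
  onto the topological dual of `D z` -/
  duality_right : ∀ {z w : Z} (h : inv z = w),
    ∃ Ψ : D w ≃SL[starRingEnd ℂ] (D z →L[ℂ] ℂ), ∀ ξ η, Ψ η ξ = pair h ξ η
  conj_pair : ∀ {z w : Z} (h : inv z = w) (h' : inv w = z) (ξ : D z) (η : D w),
    conj (pair h ξ η) = pair h' η ξ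
  /-- smoothness of the pairing in trivializations `e` around `z` and `e'` around `z^{-*}` -/
  smooth_pair : ∀ (e e' : Trivialization E (π E D)) [MemTrivializationAtlas e]
    [MemTrivializationAtlas e'],
    ContMDiffOn (𝓘(ℝ, B).prod (𝓘(ℝ, E).prod 𝓘(ℝ, E))) 𝓘(ℝ, ℂ) ∞
      (fun p : Z × E × E =>
        pair (rfl : inv p.1 = inv p.1) (e.symm p.1 p.2.1) (e'.symm (inv p.1) p.2.2))
      {p | p.1 ∈ e.baseSet ∧ inv p.1 ∈ e'.baseSet}

end LikeHermitian

/-! ### Reproducing `(-*)`-kernels -/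

section Kernel

variable {Z B E : Type*} {D : Z → Type*}
  [NormedAddCommGroup B] [NormedSpace ℝ B] [TopologicalSpace Z] [ChartedSpace B Z]
  [NormedAddCommGroup E] [NormedSpace ℂ E]
  [∀ z, AddCommGroup (D z)] [∀ z, Module ℂ (D z)] [∀ z, TopologicalSpace (D z)]
  [TopologicalSpace (TotalSpace E D)] [FiberBundle E D]

/-- A reproducing `(-*)`-kernel: a (not necessarily continuous) section of the bundle
`Hom(p₂^*Π, p₁^*Π)` over `Z × Z` which is `(-*)`-positive definite.  In `nonneg` one has
`s j = (t j)^{-*}`, and `0 ≤ c` for a complex number `c` means that `c` is real and nonnegative. -/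
structure ReproducingKernel (P : LikeHermitianStructure B E D) where
  toFun : ∀ s t : Z, D t →L[ℂ] D s
  nonneg : ∀ (n : ℕ) (t s : Fin n → Z) (h : ∀ j, P.inv (t j) = s j) (η : ∀ j, D (s j)),
    0 ≤ ∑ j, ∑ l, P.pair (h l) (toFun (t l) (s j) (η j)) (η l)

namespace ReproducingKernel

variable {P : LikeHermitianStructure B E D} (K : ReproducingKernel P)

/-- Continuity of the kernel as a section of the Banach vector bundle `Hom(p₂^*Π, p₁^*Π)` over
`Z × Z`.  The topology of that bundle is the one for which the trivializations `e` of `D` over `U`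
and `e'` of `D` over `V` induce a homeomorphism of the part of the bundle over `U × V` onto
`U × V × 𝓑(E, E)`, `(T : D t → D s) ↦ (s, t, e_s ∘ T ∘ (e'_t)⁻¹)`, with the operator norm topology
on `𝓑(E, E)`. -/
def IsContinuous [VectorBundle ℂ E D] : Prop :=
  ∀ (e e' : Trivialization E (π E D)) [MemTrivializationAtlas e] [MemTrivializationAtlas e'],
    ContinuousOn
      (fun x : Z × Z => (e.continuousLinearMapAt ℂ x.1).comp
        ((K.toFun x.1 x.2).comp (e'.symmL ℂ x.2)) : Z × Z → (E →L[ℂ] E))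
      (e.baseSet ×ˢ e'.baseSet)

/-- The section `K_ξ = K(·, s)ξ` of `D`, for `ξ` in the fiber over `s`, as a linear map in `ξ`. -/
def sec (s : Z) : D s →ₗ[ℂ] (∀ z, D z) :=
  LinearMap.pi fun z => (K.toFun z s : D s →ₗ[ℂ] D z)

/-- `𝓗₀^K`, the linear span of the sections `K_ξ`, `ξ ∈ D`.  (A type of its own, so that it does
not carry the topology of pointwise convergence.) -/
def PreRKHS : Type _ :=
  Submodule.span ℂ (Set.range fun ξ : TotalSpace E D => K.sec ξ.proj ξ.snd)

instance : AddCommGroup K.PreRKHS := inferInstanceAs (AddCommGroup (Submodule.span ℂ _))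

instance : Module ℂ K.PreRKHS := inferInstanceAs (Module ℂ (Submodule.span ℂ _))

/-- An element of `𝓗₀^K` as a section of `D`. -/
def PreRKHS.toSection : K.PreRKHS →ₗ[ℂ] (∀ z, D z) := Submodule.subtype _

theorem PreRKHS.toSection_injective : Function.Injective (PreRKHS.toSection K) :=
  Subtype.val_injective

/-- `ξ ↦ K_ξ` as a map from the fiber over `s` into `𝓗₀^K`. -/
def preHat (s : Z) : D s →ₗ[ℂ] K.PreRKHS :=
  (K.sec s).codRestrict _ fun ξ =>
    Submodule.subset_span ⟨(⟨s, ξ⟩ : TotalSpace E D), rfl⟩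

@[simp]
theorem toSection_preHat (s : Z) (ξ : D s) (z : Z) :
    PreRKHS.toSection K (K.preHat s ξ) z = K.toFun z s ξ := rfl

/-- The linear combination `∑ c_ξ K_ξ` in `𝓗₀^K`. -/
def comb : (TotalSpace E D →₀ ℂ) →ₗ[ℂ] K.PreRKHS :=
  Finsupp.linearCombination ℂ fun ξ : TotalSpace E D => K.preHat ξ.proj ξ.snd

theorem comb_surjective : Function.Surjective K.comb := by
  intro f
  have hf : PreRKHS.toSection K f ∈
      Submodule.span ℂ (Set.range fun ξ : TotalSpace E D => K.sec ξ.proj ξ.snd) := f.2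
  obtain ⟨c, hc⟩ := (Finsupp.mem_span_range_iff_exists_finsupp).1 hf
  refine ⟨c, PreRKHS.toSection_injective K ?_⟩
  rw [← hc, comb, Finsupp.linearCombination_apply, map_finsuppSum]
  rfl

/-- `f ↦ (f(s^{-*}) ∣ ξ)_{s^{-*}, s}` for `ξ` in the fiber over `s`. -/
def evalPair (ξ : TotalSpace E D) : K.PreRKHS →ₗ[ℂ] ℂ :=
  ((P.pair (P.inv_inv ξ.proj)).flip ξ.snd).comp
    ((LinearMap.proj (P.inv ξ.proj)).comp (PreRKHS.toSection K))

/-- The form `(c, f) ↦ ∑ conj(c_ξ) (f(s^{-*}) ∣ ξ)_{s^{-*}, s}`. -/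
def form (c : TotalSpace E D →₀ ℂ) (f : K.PreRKHS) : ℂ :=
  c.sum fun ξ a => conj a * K.evalPair ξ f

theorem form_add_left (c d : TotalSpace E D →₀ ℂ) (f : K.PreRKHS) :
    K.form (c + d) f = K.form c f + K.form d f := by
  classical
  exact Finsupp.sum_add_index' (by simp) (by intro ξ a b; simp [add_mul])

theorem form_smul_left (r : ℂ) (c : TotalSpace E D →₀ ℂ) (f : K.PreRKHS) :
    K.form (r • c) f = conj r * K.form c f := by
  rw [form, form, Finsupp.sum_smul_index (by simp), Finsupp.mul_sum]
  simp [mul_assoc]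

theorem form_add_right (c : TotalSpace E D →₀ ℂ) (f g : K.PreRKHS) :
    K.form c (f + g) = K.form c f + K.form c g := by
  simp [form, mul_add, Finsupp.sum_add]

theorem form_smul_right (r : ℂ) (c : TotalSpace E D →₀ ℂ) (f : K.PreRKHS) :
    K.form c (r • f) = r * K.form c f := by
  rw [form, form, Finsupp.mul_sum]
  simp [mul_left_comm]

theorem form_comb_nonneg (c : TotalSpace E D →₀ ℂ) : 0 ≤ K.form c (K.comb c) := by
  have key : K.form c (K.comb c) = ∑ ξ ∈ c.support, ∑ η ∈ c.support,
      P.pair (P.inv_inv η.proj) (K.toFun (P.inv η.proj) ξ.proj (c ξ • ξ.snd)) (c η • η.snd) := by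
    rw [Finset.sum_comm, form, Finsupp.sum]
    refine Finset.sum_congr rfl fun η _ => ?_
    rw [comb, Finsupp.linearCombination_apply, Finsupp.sum, map_sum, Finset.mul_sum]
    refine Finset.sum_congr rfl fun ξ _ => ?_
    simp [evalPair]
  rw [key]
  let e := c.support.equivFin.symm
  have h := K.nonneg c.support.card (fun j => P.inv (e j).1.proj) (fun j => (e j).1.proj)
    (fun j => P.inv_inv _) (fun j => c (e j).1 • (e j).1.snd)
  refine h.trans_eq ?_
  rw [← Finset.sum_coe_sort (f := fun ξ : TotalSpace E D => ∑ η ∈ c.support,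
    P.pair (P.inv_inv η.proj) (K.toFun (P.inv η.proj) ξ.proj (c ξ • ξ.snd)) (c η • η.snd))]
  refine Fintype.sum_equiv e _ _ fun j => ?_
  rw [← Finset.sum_coe_sort c.support]
  exact Fintype.sum_equiv e _ _ fun l => rfl

theorem conj_form_comb (c d : TotalSpace E D →₀ ℂ) :
    conj (K.form c (K.comb d)) = K.form d (K.comb c) := by
  have h0 : ∀ c, (K.form c (K.comb c)).im = 0 := fun c =>
    (Complex.le_def.1 (K.form_comb_nonneg c)).2.symm
  have h1 := h0 (c + d)
  have h2 := h0 (c + Complex.I • d)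
  have hc := h0 c
  have hd := h0 d
  simp only [map_add, map_smul, form_add_left, form_add_right, form_smul_left, form_smul_right]
    at h1 h2
  simp [hc, hd] at h1 h2
  apply Complex.ext
  · rw [Complex.conj_re]
    linarith
  · rw [Complex.conj_im]
    linarith

/-- The scalar product of `𝓗₀^K`, antilinear in the first variable as usual in Mathlib; it is
characterized by `preInner_preHat`. -/
def preInner (g f : K.PreRKHS) : ℂ := K.form (Function.surjInv K.comb_surjective g) f

theorem conj_preInner (f g : K.PreRKHS) : conj (K.preInner g f) = K.preInner f g := by
  have hf := Function.surjInv_eq K.comb_surjective f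
  have hg := Function.surjInv_eq K.comb_surjective g
  have h := K.conj_form_comb (Function.surjInv K.comb_surjective g)
    (Function.surjInv K.comb_surjective f)
  rwa [hf, hg] at h

theorem preInner_comb (c : TotalSpace E D →₀ ℂ) (f : K.PreRKHS) :
    K.preInner (K.comb c) f = K.form c f := by
  obtain ⟨d, rfl⟩ := K.comb_surjective f
  have hc := Function.surjInv_eq K.comb_surjective (K.comb c)
  rw [preInner, ← conj_form_comb, hc, conj_form_comb]

/-- The reproducing property `(f ∣ K_ξ) = (f(z) ∣ ξ)_{z, s}` for `ξ` in the fiber over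
`s = z^{-*}`. -/
theorem preInner_preHat {z s : Z} (h : P.inv z = s) (ξ : D s) (f : K.PreRKHS) :
    K.preInner (K.preHat s ξ) f = P.pair h (PreRKHS.toSection K f z) ξ := by
  have h' : P.inv s = z := by rw [← h, P.inv_inv]
  subst h'
  have h := K.preInner_comb (Finsupp.single (⟨s, ξ⟩ : TotalSpace E D) 1) f
  simpa [comb, form, evalPair] using h

/-- `𝓗₀^K` as a semi-inner product space. -/
@[reducible] def preCore : PreInnerProductSpace.Core ℂ K.PreRKHS where
  inner := K.preInner
  conj_inner_symm f g := K.conj_preInner f g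
  re_inner_nonneg f := by
    have h := K.form_comb_nonneg (Function.surjInv K.comb_surjective f)
    rw [Function.surjInv_eq K.comb_surjective f] at h
    exact (Complex.le_def.1 h).1
  add_left f g h := by
    rw [← K.conj_preInner, preInner, form_add_right, map_add]
    exact congrArg₂ _ (K.conj_preInner _ _) (K.conj_preInner _ _)
  smul_left f g r := by
    rw [← K.conj_preInner, preInner, form_smul_right, map_mul]
    exact congrArg _ (K.conj_preInner _ _)

theorem eq_zero_of_preInner_self (f : K.PreRKHS) (hf : K.preInner f f = 0) : f = 0 := by
  have h0 : ∀ g, K.preInner g f = 0 := fun g => by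
    have h := @InnerProductSpace.Core.inner_mul_inner_self_le ℂ K.PreRKHS _ _ _ K.preCore g f
    change ‖K.preInner g f‖ * ‖K.preInner f g‖ ≤
      RCLike.re (K.preInner g g) * RCLike.re (K.preInner f f) at h
    rw [hf, map_zero, mul_zero, ← K.conj_preInner f g, RCLike.norm_conj] at h
    exact norm_eq_zero.1 (mul_self_eq_zero.1 (le_antisymm h (mul_self_nonneg _)))
  refine PreRKHS.toSection_injective K (funext fun z => ?_)
  obtain ⟨Φ, hΦ⟩ := P.duality_left (rfl : P.inv z = P.inv z)
  have h1 : Φ (PreRKHS.toSection K f z) = 0 := by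
    ext ξ
    rw [hΦ, ← K.preInner_preHat, h0]
    rfl
  simpa using h1

/-- The scalar product of `𝓗₀^K`. -/
@[reducible] def innerCore : InnerProductSpace.Core ℂ K.PreRKHS where
  toCore := K.preCore
  definite := K.eq_zero_of_preInner_self

instance : NormedAddCommGroup K.PreRKHS := K.innerCore.toNormedAddCommGroup

instance : InnerProductSpace ℂ K.PreRKHS := .ofCore K.innerCore.toCore

/-- The defining formula `(K_η ∣ K_ξ) = (K(s^{-*}, t)η ∣ ξ)_{s^{-*}, s}` of the scalar product, for
`ξ` in the fiber over `s` and `η` in the fiber over `t`; here `z = s^{-*}`. -/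
theorem inner_preHat {z s t : Z} (h : P.inv z = s) (ξ : D s) (η : D t) :
    inner ℂ (K.preHat s ξ) (K.preHat t η) = P.pair h (K.toFun z t η) ξ :=
  K.preInner_preHat h ξ _

/-- The reproducing kernel Hilbert space `𝓗^K`, the completion of `𝓗₀^K`. -/
abbrev RKHS : Type _ := UniformSpace.Completion K.PreRKHS

/-- The restriction of `K̂ : D → 𝓗^K`, `ξ ↦ K_ξ`, to the fiber over `s`. -/
def hat (s : Z) : D s →ₗ[ℂ] K.RKHS :=
  (UniformSpace.Completion.toComplₗᵢ : K.PreRKHS →ₗᵢ[ℂ] K.RKHS).toLinearMap.comp (K.preHat s)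

end ReproducingKernel
end Kernel

/-! ### The Grassmannian of a Hilbert space -/

section Grassmannian

variable (H : Type*) [NormedAddCommGroup H] [InnerProductSpace ℂ H]

/-- The Grassmannian `Gr(H)`: the closed linear subspaces of `H`. -/
structure Grassmannian where
  carrier : Submodule ℂ H
  isClosed : IsClosed (carrier : Set H)

variable {H}

namespace Grassmannian

/-- The orthogonal projection onto an element of the Grassmannian, as an operator on `H`. -/
def proj [CompleteSpace H] (S : Grassmannian H) : H →L[ℂ] H :=
  haveI : CompleteSpace S.carrier := S.isClosed.completeSpace_coe
  S.carrier.starProjection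

/-- The topology of the Grassmann manifold `Gr(H)`, which is the one that makes `S ↦ p_S` a
homeomorphism onto the set of orthogonal projections with the operator norm topology. -/
instance [CompleteSpace H] : TopologicalSpace (Grassmannian H) :=
  TopologicalSpace.induced proj inferInstance

/-- Two subspaces are similar in `H` if some invertible bounded operator on `H` maps the first one
onto the second one. -/
def Similar (S₁ S₂ : Grassmannian H) : Prop :=
  ∃ T : H ≃L[ℂ] H, T '' (S₁.carrier : Set H) = S₂.carrier

/-- A `Gr(H)`-valued map is locally similar(-valued) if every point has a neighborhood on which its
values are similar to each other. -/
def IsLocallySimilar {X : Type*} [TopologicalSpace X] (F : X → Grassmannian H) : Prop :=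
  ∀ x, ∃ V ∈ 𝓝 x, ∀ y ∈ V, ∀ z ∈ V, Similar (F y) (F z)

end Grassmannian

end Grassmannian

/-- The map `ζ_K : Z → Gr(𝓗^K)`, `ζ_K(s)` being the closure of `K̂(D_s)`. -/
def ReproducingKernel.zeta {Z B E : Type*} {D : Z → Type*}
    [NormedAddCommGroup B] [NormedSpace ℝ B] [TopologicalSpace Z] [ChartedSpace B Z]
    [NormedAddCommGroup E] [NormedSpace ℂ E]
    [∀ z, AddCommGroup (D z)] [∀ z, Module ℂ (D z)] [∀ z, TopologicalSpace (D z)]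
    [TopologicalSpace (TotalSpace E D)] [FiberBundle E D]
    {P : LikeHermitianStructure B E D} (K : ReproducingKernel P) (s : Z) :
    Grassmannian K.RKHS where
  carrier := (LinearMap.range (K.hat s)).topologicalClosure
  isClosed := Submodule.isClosed_topologicalClosure _

end

/-! A norm-continuous family of projections has nearby values, and projections at distance less than
1 have similar ranges; this turns continuity into local similarity
(`similar_of_norm_proj_sub_lt_one`). The substance is that conditions 1 and 2 make `K.zeta`
continuous. In a trivialization of the bundle, the restrictions of $\widehat K$ to the fibers become
operators $A_s\colon\mathcal E\to\mathcal H^K$, and their Gram kernel $(A_t y\mid A_s x)$ is the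
pairing applied to $K(s^{-*},t)$. The pairing is only assumed jointly smooth, but a jointly $C^1$
map is locally Lipschitz, and homogeneity upgrades a Lipschitz bound near the zero vectors to
continuity in the norm of sesquilinear forms (`eventually_trivPair_sub_le`). With the norm
continuity of $K$, the Gram kernel is therefore norm continuous at $(s_0,s_0)$. Expanding $\|A_s
x-A_{s_0}x\|^2$ into Gram terms shows that $s\mapsto A_s$ is norm continuous
(`continuousAt_of_eventually_inner_sub_le`). By condition 2, $A_{s_0}$ is bounded below and
$\zeta_K(s)$ is the range of $A_s$. A small perturbation of an operator bounded below moves its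
range by a small gap, which controls the distance of the projections (`continuousAt_of_range`). -/

noncomputable section

/-! ### Projections, gaps and similarity in the Grassmannian -/

namespace Grassmannian

variable {H : Type*} [NormedAddCommGroup H] [InnerProductSpace ℂ H] [CompleteSpace H]

theorem isStarProjection_proj (S : Grassmannian H) : IsStarProjection S.proj := by
  have : CompleteSpace S.carrier := S.isClosed.completeSpace_coe
  exact isStarProjection_starProjection

theorem range_proj (S : Grassmannian H) : Set.range S.proj = S.carrier := by
  have : CompleteSpace S.carrier := S.isClosed.completeSpace_coe
  have h := S.carrier.range_starProjection
  exact congrArg (fun U : Submodule ℂ H => (U : Set H)) h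

theorem norm_sub_proj_le (S : Grassmannian H) (v : H) {w : H} (hw : w ∈ S.carrier) :
    ‖v - S.proj v‖ ≤ ‖v - w‖ := by
  have : CompleteSpace S.carrier := S.isClosed.completeSpace_coe
  have h := S.carrier.starProjection_minimal (y := v)
  change ‖v - S.carrier.starProjection v‖ ≤ _
  rw [h]
  exact ciInf_le ⟨0, by rintro _ ⟨x, rfl⟩; positivity⟩ (⟨w, hw⟩ : S.carrier)

theorem norm_proj_le (S : Grassmannian H) (v : H) : ‖S.proj v‖ ≤ ‖v‖ := by
  have : CompleteSpace S.carrier := S.isClosed.completeSpace_coe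
  exact S.carrier.norm_starProjection_apply_le v

theorem proj_mem (S : Grassmannian H) (v : H) : S.proj v ∈ S.carrier := by
  have h : S.proj v ∈ Set.range S.proj := ⟨v, rfl⟩
  rwa [range_proj] at h

/-- The distance of two projections is controlled by the two gaps between their ranges. -/
theorem norm_proj_sub_proj_le {S₁ S₂ : Grassmannian H} {δ : ℝ} (hδ : 0 ≤ δ)
    (h₁ : ∀ v ∈ S₁.carrier, ∃ w ∈ S₂.carrier, ‖v - w‖ ≤ δ * ‖v‖)
    (h₂ : ∀ v ∈ S₂.carrier, ∃ w ∈ S₁.carrier, ‖v - w‖ ≤ δ * ‖v‖) :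
    ‖S₁.proj - S₂.proj‖ ≤ 2 * δ := by
  have gap : ∀ {S T : Grassmannian H},
      (∀ v ∈ S.carrier, ∃ w ∈ T.carrier, ‖v - w‖ ≤ δ * ‖v‖) →
      ‖(1 - T.proj) * S.proj‖ ≤ δ := by
    intro S T h
    refine ContinuousLinearMap.opNorm_le_bound _ hδ fun v => ?_
    obtain ⟨w, hw, hvw⟩ := h _ (S.proj_mem v)
    calc ‖((1 - T.proj) * S.proj) v‖ = ‖S.proj v - T.proj (S.proj v)‖ := rfl
      _ ≤ ‖S.proj v - w‖ := T.norm_sub_proj_le _ hw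
      _ ≤ δ * ‖S.proj v‖ := hvw
      _ ≤ δ * ‖v‖ := mul_le_mul_of_nonneg_left (S.norm_proj_le v) hδ
  -- The second gap bounds $(1-p_1)p_2$, whereas the decomposition of $p_1-p_2$ below needs its
  -- adjoint, which has the same norm.
  have hstar : star ((1 - S₁.proj) * S₂.proj) = S₂.proj * (1 - S₁.proj) := by
    rw [star_mul, star_sub, star_one, S₁.isStarProjection_proj.isSelfAdjoint.star_eq,
      S₂.isStarProjection_proj.isSelfAdjoint.star_eq]
  have h₂' : ‖S₂.proj * (1 - S₁.proj)‖ ≤ δ := by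
    rw [← hstar, norm_star]
    exact gap h₂
  have heq : S₁.proj - S₂.proj = (1 - S₂.proj) * S₁.proj - S₂.proj * (1 - S₁.proj) := by
    noncomm_ring
  rw [heq, two_mul]
  exact (norm_sub_le _ _).trans (add_le_add (gap h₁) h₂')

/-- The operator $T=qp+(1-q)(1-p)$ intertwines $p$ and $q$. With $R$ obtained by exchanging $p$ and
$q$, $TR=RT=1-(p-q)^2$, which is invertible by the Neumann series. -/
theorem similar_of_norm_proj_sub_lt_one {S₁ S₂ : Grassmannian H}
    (h : ‖S₁.proj - S₂.proj‖ < 1) : Similar S₁ S₂ := by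
  have hp := S₁.isStarProjection_proj.isIdempotentElem.eq
  have hq := S₂.isStarProjection_proj.isIdempotentElem.eq
  have r₁ := S₁.range_proj
  have r₂ := S₂.range_proj
  set p := S₁.proj
  set q := S₂.proj
  let T := q * p + (1 - q) * (1 - p)
  let R := p * q + (1 - p) * (1 - q)
  have hqq : ∀ x, q * (q * x) = q * x := fun x => by rw [← mul_assoc, hq]
  have hpp : ∀ x, p * (p * x) = p * x := fun x => by rw [← mul_assoc, hp]
  have hRT : R * T = 1 - (p - q) * (p - q) := by
    simp only [R, T, mul_add, add_mul, mul_sub, sub_mul, one_mul, mul_one, mul_assoc, hp, hq,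
      hqq]
    abel
  have hTR : T * R = 1 - (p - q) * (p - q) := by
    simp only [R, T, mul_add, add_mul, mul_sub, sub_mul, one_mul, mul_one, mul_assoc, hp, hq,
      hpp]
    abel
  have hTp : T * p = q * T := by
    simp only [T, mul_add, add_mul, mul_sub, sub_mul, one_mul, mul_one, mul_assoc, hp, hq, hqq]
    abel
  have hlt : ‖(p - q) * (p - q)‖ < 1 := by
    refine (norm_mul_le _ _).trans_lt ?_
    nlinarith [norm_nonneg (p - q)]
  have hu : IsUnit (T * R) := by
    rw [hTR]
    exact isUnit_one_sub_of_norm_lt_one hlt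
  have hT : IsUnit T := ((show Commute T R from hTR.trans hRT.symm).isUnit_mul_iff.1 hu).1
  obtain ⟨u, hu⟩ := hT
  let U := ContinuousLinearEquiv.unitsEquiv ℂ H u
  have hU : ∀ x, U x = T x := fun x => by rw [← hu]; rfl
  refine ⟨U, ?_⟩
  rw [← r₁, ← r₂, ← Set.range_comp]
  have hcomp : (U : H → H) ∘ p = q ∘ U := by
    funext x
    simp only [Function.comp_apply, hU]
    exact congrArg (fun A : H →L[ℂ] H => A x) hTp
  rw [hcomp, Set.range_comp, U.surjective.range_eq, Set.image_univ]

theorem isLocallySimilar_of_continuous {X : Type*} [TopologicalSpace X] {F : X → Grassmannian H}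
    (hF : Continuous F) : IsLocallySimilar F := by
  have hc : Continuous fun x => (F x).proj := continuous_induced_dom.comp hF
  intro x
  refine ⟨_, hc.continuousAt (Metric.ball_mem_nhds (F x).proj one_half_pos), fun y hy z hz => ?_⟩
  refine similar_of_norm_proj_sub_lt_one ?_
  rw [← dist_eq_norm]
  have hy' : dist (F y).proj (F x).proj < 1 / 2 := hy
  have hz' : dist (F z).proj (F x).proj < 1 / 2 := hz
  linarith [dist_triangle_right (F y).proj (F z).proj (F x).proj]

/-- If the elements of the Grassmannian are the ranges of operators which depend continuously on
the point in the operator norm and are bounded below, then they depend continuously on the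
point. -/
theorem continuousAt_of_range {X E : Type*} [TopologicalSpace X] [NormedAddCommGroup E]
    [NormedSpace ℂ E] {F : X → Grassmannian H} {A : X → E →L[ℂ] H} {x₀ : X}
    (hA : ContinuousAt A x₀) (hrange : ∀ᶠ x in 𝓝 x₀, Set.range (A x) = (F x).carrier)
    {c : ℝ} (hc : 0 < c) (hbelow : ∀ v, c * ‖v‖ ≤ ‖A x₀ v‖) : ContinuousAt F x₀ := by
  rw [(Topology.IsInducing.induced proj).continuousAt_iff]
  rw [Metric.continuousAt_iff']
  intro ε hε
  have hr₀ := hrange.self_of_nhds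
  -- Perturbing by $c\delta/2$ keeps the lower bound $c/2$ since $\delta\le1$. The relative gap is
  -- then at most $(c\delta/2)/(c/2)=\delta$, and the projections differ by at most
  -- $2\delta<\varepsilon$.
  let δ := min (ε / 4) (1 / 2)
  have hδ : 0 < δ := by positivity
  filter_upwards [hrange, Metric.continuousAt_iff'.1 hA (c * δ / 2) (by positivity)] with x hx hAx
  rw [dist_eq_norm] at hAx
  have hdiff : ∀ v, ‖A x v - A x₀ v‖ ≤ c * δ / 2 * ‖v‖ := fun v =>
    ((A x - A x₀).le_opNorm v).trans (by gcongr)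
  have hbelow' : ∀ v, c / 2 * ‖v‖ ≤ ‖A x v‖ := fun v => by
    have h1 := norm_sub_norm_le (A x₀ v) (A x v)
    rw [norm_sub_rev] at h1
    have h2 := hdiff v
    have h3 := hbelow v
    have h4 : c * δ / 2 * ‖v‖ ≤ c / 2 * ‖v‖ := by
      have : δ ≤ 1 := (min_le_right _ _).trans (by norm_num)
      gcongr
      nlinarith
    linarith
  have hle : ‖(F x).proj - (F x₀).proj‖ ≤ 2 * δ := by
    refine norm_proj_sub_proj_le hδ.le ?_ ?_
    · intro v hv
      rw [← SetLike.mem_coe, ← hx] at hv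
      obtain ⟨y, rfl⟩ := hv
      refine ⟨A x₀ y, by rw [← SetLike.mem_coe, ← hr₀]; exact ⟨y, rfl⟩, (hdiff y).trans ?_⟩
      nlinarith [hbelow' y]
    · intro v hv
      rw [← SetLike.mem_coe, ← hr₀] at hv
      obtain ⟨y, rfl⟩ := hv
      refine ⟨A x y, by rw [← SetLike.mem_coe, ← hx]; exact ⟨y, rfl⟩, ?_⟩
      rw [norm_sub_rev]
      refine (hdiff y).trans ?_
      nlinarith [hbelow y, norm_nonneg y, mul_nonneg hc.le (norm_nonneg y)]
  change dist (F x).proj (F x₀).proj < ε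
  rw [dist_eq_norm]
  have : δ ≤ ε / 4 := min_le_left _ _
  linarith

end Grassmannian

/-! ### Norm estimates from homogeneity and from Gram kernels -/

/-- A form which is homogeneous under real scalars and bounded by `η` on a product of two balls of
radius `r` is bounded by `η / r ^ 2`. -/
theorem norm_le_of_homogeneous_of_bound {E : Type*} [NormedAddCommGroup E] [NormedSpace ℝ E]
    {f : E → E → ℂ} (hf : ∀ (a c : ℝ) (u x : E), f (a • u) (c • x) = a * c * f u x) {r η : ℝ}
    (hr : 0 < r) (hη : ∀ u x, ‖u‖ ≤ r → ‖x‖ ≤ r → ‖f u x‖ ≤ η) (u x : E) :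
    ‖f u x‖ ≤ η / r ^ 2 * ‖u‖ * ‖x‖ := by
  rcases eq_or_ne u 0 with rfl | hu
  · have h := hf 0 1 0 x
    simp only [smul_zero, one_smul, Complex.ofReal_zero, zero_mul] at h
    simp [h]
  rcases eq_or_ne x 0 with rfl | hx
  · have h := hf 1 0 u 0
    simp only [smul_zero, one_smul, Complex.ofReal_zero, zero_mul, mul_zero] at h
    simp [h]
  have hu' : 0 < ‖u‖ := norm_pos_iff.2 hu
  have hx' : 0 < ‖x‖ := norm_pos_iff.2 hx
  have hscale : ∀ v : E, 0 < ‖v‖ → ‖(r / ‖v‖) • v‖ ≤ r := fun v hv => by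
    rw [norm_smul, Real.norm_of_nonneg (by positivity), div_mul_cancel₀ _ hv.ne']
  have h := hη _ _ (hscale u hu') (hscale x hx')
  rw [hf, norm_mul, norm_mul, Complex.norm_real, Complex.norm_real,
    Real.norm_of_nonneg (by positivity), Real.norm_of_nonneg (by positivity)] at h
  calc ‖f u x‖ = (r / ‖u‖ * (r / ‖x‖) * ‖f u x‖) / r ^ 2 * ‖u‖ * ‖x‖ := by field_simp
    _ ≤ η / r ^ 2 * ‖u‖ * ‖x‖ := by gcongr

/-- A family of operators into an inner product space depends continuously on the point in the
operator norm as soon as its Gram kernel does. -/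
theorem continuousAt_of_eventually_inner_sub_le {X E H : Type*} [TopologicalSpace X]
    [NormedAddCommGroup E] [NormedSpace ℂ E] [NormedAddCommGroup H] [InnerProductSpace ℂ H]
    {A : X → E →L[ℂ] H} {s₀ : X}
    (hA : ∀ ε : ℝ, 0 < ε → ∀ᶠ p : X × X in 𝓝 (s₀, s₀), ∀ x y,
      ‖(inner ℂ (A p.1 x) (A p.2 y) : ℂ) - inner ℂ (A s₀ x) (A s₀ y)‖ ≤ ε * ‖x‖ * ‖y‖) :
    ContinuousAt A s₀ := by
  rw [Metric.continuousAt_iff']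
  intro ε hε
  -- Three Gram differences enter the square below, and $3(\varepsilon/4)^2\le(\varepsilon/2)^2$.
  have hev := hA ((ε / 4) ^ 2) (by positivity)
  have hd : Filter.Tendsto (fun s => (s, s)) (𝓝 s₀) (𝓝 (s₀, s₀)) :=
    (continuous_id.prodMk continuous_id).tendsto s₀
  have hl : Filter.Tendsto (fun s => (s, s₀)) (𝓝 s₀) (𝓝 (s₀, s₀)) :=
    (continuous_id.prodMk continuous_const).tendsto s₀
  have hr : Filter.Tendsto (fun s => (s₀, s)) (𝓝 s₀) (𝓝 (s₀, s₀)) :=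
    (continuous_const.prodMk continuous_id).tendsto s₀
  filter_upwards [hd.eventually hev, hl.eventually hev, hr.eventually hev] with s h1 h2 h3
  rw [dist_eq_norm]
  refine (ContinuousLinearMap.opNorm_le_bound _ (M := ε / 2) (by positivity) fun x => ?_).trans_lt
    (half_lt_self hε)
  rw [sub_apply]
  have hsq : ‖A s x - A s₀ x‖ ^ 2 ≤ (ε / 2 * ‖x‖) ^ 2 := by
    have h1 := h1 x x
    have h2 := h2 x x
    have h3 := h3 x x
    set a := A s x
    set b := A s₀ x
    have hid : (inner ℂ (a - b) (a - b) : ℂ) = (inner ℂ a a - inner ℂ b b) -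
        (inner ℂ a b - inner ℂ b b) - (inner ℂ b a - inner ℂ b b) := by
      rw [inner_sub_left, inner_sub_right, inner_sub_right]
      ring
    have hn : ‖a - b‖ ^ 2 = ‖(inner ℂ (a - b) (a - b) : ℂ)‖ := by
      rw [inner_self_eq_norm_sq_to_K]
      simp
    rw [hn, hid]
    refine (norm_sub_le _ _).trans ((add_le_add (norm_sub_le _ _) le_rfl).trans ?_)
    nlinarith [sq_nonneg (ε * ‖x‖)]
  exact (abs_le_of_sq_le_sq' hsq (by positivity)).2

/-! ### The kernel map and the pairing in local trivializations -/

section Bundle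

variable {Z B E : Type*} {D : Z → Type*}
  [NormedAddCommGroup B] [NormedSpace ℝ B] [TopologicalSpace Z] [ChartedSpace B Z]
  [NormedAddCommGroup E] [NormedSpace ℂ E]
  [∀ z, AddCommGroup (D z)] [∀ z, Module ℂ (D z)] [∀ z, TopologicalSpace (D z)]
  [TopologicalSpace (TotalSpace E D)] [FiberBundle E D]

namespace ReproducingKernel

variable {P : LikeHermitianStructure B E D} (K : ReproducingKernel P)

theorem inner_hat {z s t : Z} (h : P.inv z = s) (ξ : D s) (η : D t) :
    inner ℂ (K.hat s ξ) (K.hat t η) = P.pair h (K.toFun z t η) ξ := by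
  rw [← K.inner_preHat h]
  exact UniformSpace.Completion.inner_coe _ _

theorem norm_hat {z s : Z} (h : P.inv z = s) (ξ : D s) :
    ‖K.hat s ξ‖ = √(RCLike.re (P.pair h (K.toFun z s ξ) ξ)) := by
  rw [← K.inner_hat h, norm_eq_sqrt_re_inner (𝕜 := ℂ)]

theorem carrier_zeta {s : Z} (hclosed : IsClosed (Set.range (K.hat s))) :
    ((K.zeta s).carrier : Set K.RKHS) = Set.range (K.hat s) := by
  have h : ((K.zeta s).carrier : Set K.RKHS) = closure (Set.range (K.hat s)) := by
    rw [← LinearMap.coe_range]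
    exact Submodule.topologicalClosure_coe _
  rw [h, hclosed.closure_eq]

end ReproducingKernel

variable [VectorBundle ℂ E D]

namespace LikeHermitianStructure

variable (P : LikeHermitianStructure B E D)
  (e e' : Trivialization E (π E D)) [MemTrivializationAtlas e] [MemTrivializationAtlas e']

/-- The pairing read in two trivializations. -/
def trivPair (z : Z) (u x : E) : ℂ :=
  P.pair (rfl : P.inv z = P.inv z) (e.symmL ℂ z u) (e'.symmL ℂ (P.inv z) x)

theorem pair_symmL {z w : Z} (h : P.inv z = w) (u x : E) :
    P.pair h (e.symmL ℂ z u) (e'.symmL ℂ w x) = P.trivPair e e' z u x := by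
  subst h
  rfl

theorem trivPair_smul_smul (z : Z) (a c : ℝ) (u x : E) :
    P.trivPair e e' z (a • u) (c • x) = a * c * P.trivPair e e' z u x := by
  rw [← Complex.coe_smul a u, ← Complex.coe_smul c x]
  simp only [trivPair, map_smul, map_smulₛₗ, LinearMap.smul_apply, smul_eq_mul,
    Complex.conj_ofReal]
  ring

theorem trivPair_sub_left (z : Z) (u v x : E) :
    P.trivPair e e' z (u - v) x = P.trivPair e e' z u x - P.trivPair e e' z v x := by
  simp only [trivPair, map_sub, LinearMap.sub_apply]

theorem continuous_trivPair (z : Z) :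
    Continuous fun p : E × E => P.trivPair e e' z p.1 p.2 :=
  (P.continuous_pair rfl).comp
    (((e.symmL ℂ z).continuous.comp continuous_fst).prodMk
      ((e'.symmL ℂ (P.inv z)).continuous.comp continuous_snd))

/-- Continuity at the origin bounds the form by 1 on a product of small balls, and homogeneity does
the rest. -/
theorem exists_trivPair_le (z : Z) :
    ∃ C, 0 ≤ C ∧ ∀ u x, ‖P.trivPair e e' z u x‖ ≤ C * ‖u‖ * ‖x‖ := by
  have h0 : P.trivPair e e' z 0 0 = 0 := by simp [trivPair]
  have hc := (P.continuous_trivPair e e' z).continuousAt (x := (0, 0))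
  obtain ⟨r, hr, h⟩ := Metric.continuousAt_iff.1 hc 1 one_pos
  refine ⟨1 / (r / 2) ^ 2, by positivity, norm_le_of_homogeneous_of_bound
    (P.trivPair_smul_smul e e' z) (half_pos hr) fun u x hu hx => ?_⟩
  have hux : dist (u, x) ((0, 0) : E × E) < r := by
    rw [Prod.dist_eq, dist_zero_right, dist_zero_right]
    exact (max_le hu hx).trans_lt (half_lt_self hr)
  have h := (h hux).le
  rwa [h0, dist_zero_right] at h

/-- Smoothness of the pairing implies that, read in trivializations, it depends continuously on the
point in the norm of bounded sesquilinear forms. -/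
theorem eventually_trivPair_sub_le [IsManifold 𝓘(ℝ, B) ∞ Z] {z₀ : Z} (h : z₀ ∈ e.baseSet)
    (h' : P.inv z₀ ∈ e'.baseSet) {ε : ℝ} (hε : 0 < ε) :
    ∀ᶠ z in 𝓝 z₀, ∀ u x,
      ‖P.trivPair e e' z u x - P.trivPair e e' z₀ u x‖ ≤ ε * ‖u‖ * ‖x‖ := by
  let s : Set (Z × E × E) := {p | p.1 ∈ e.baseSet ∧ P.inv p.1 ∈ e'.baseSet}
  have hs : s ∈ 𝓝 (z₀, (0 : E), (0 : E)) := by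
    refine IsOpen.mem_nhds ?_ ⟨h, h'⟩
    exact (e.open_baseSet.preimage continuous_fst).inter
      (e'.open_baseSet.preimage (P.inv.continuous.comp continuous_fst))
  have hsm := (P.smooth_pair e e').contMDiffAt hs
  have hsm' : ContMDiffAt (𝓘(ℝ, B).prod (𝓘(ℝ, E).prod 𝓘(ℝ, E))) 𝓘(ℝ, ℂ) ∞
      (fun p : Z × E × E => P.trivPair e e' p.1 p.2.1 p.2.2) (z₀, (0 : E), (0 : E)) := by
    refine hsm.congr_of_eventuallyEq ?_
    filter_upwards [hs] with p hp
    simp only [trivPair]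
    rw [e.symmL_apply hp.1, e'.symmL_apply hp.2]
  -- A chart of the base replaces the manifold by the normed space $B$, where $C^1$ gives a
  -- Lipschitz constant on a neighborhood.
  let φ := extChartAt 𝓘(ℝ, B) z₀
  let v₀ := φ z₀
  have hφ : ContMDiffAt 𝓘(ℝ, B) 𝓘(ℝ, B) ∞ φ.symm v₀ :=
    (contMDiffOn_extChartAt_symm z₀).contMDiffAt (extChartAt_target_mem_nhds z₀)
  have hφ₀ : φ.symm v₀ = z₀ := extChartAt_to_inv z₀
  have hg : ContMDiffAt 𝓘(ℝ, B × E × E) 𝓘(ℝ, ℂ) ∞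
      (fun p : B × E × E => P.trivPair e e' (φ.symm p.1) p.2.1 p.2.2) (v₀, (0 : E), (0 : E)) := by
    have hpr : ContMDiffAt 𝓘(ℝ, B × E × E) (𝓘(ℝ, B).prod (𝓘(ℝ, E).prod 𝓘(ℝ, E))) ∞
        (fun p : B × E × E => (φ.symm p.1, p.2.1, p.2.2)) (v₀, (0 : E), (0 : E)) :=
      (ContMDiffAt.comp (v₀, (0 : E), (0 : E)) hφ contDiffAt_fst.contMDiffAt).prodMk
        ((contDiff_fst.comp contDiff_snd).contDiffAt.contMDiffAt.prodMk
          (contDiff_snd.comp contDiff_snd).contDiffAt.contMDiffAt)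
    refine ContMDiffAt.comp (I' := 𝓘(ℝ, B).prod (𝓘(ℝ, E).prod 𝓘(ℝ, E)))
      (g := fun p : Z × E × E => P.trivPair e e' p.1 p.2.1 p.2.2) (v₀, (0 : E), (0 : E)) ?_ hpr
    simpa only [hφ₀] using hsm'
  rw [contMDiffAt_iff_contDiffAt] at hg
  obtain ⟨C, t, ht, hC⟩ :=
    (hg.of_le (by exact_mod_cast le_top : (1 : WithTop ℕ∞) ≤ ∞)).exists_lipschitzOnWith
  obtain ⟨r, hr, hrt⟩ := Metric.mem_nhds_iff.1 ht
  -- The first bound keeps the point in the Lipschitz ball. The second makes the Lipschitz error at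
  -- most $\varepsilon(r/2)^2$, which rescaling from radius $r/2$ turns into $\varepsilon$; $C+1$
  -- avoids division by zero.
  let δ := min r (ε * (r / 2) ^ 2 / (C + 1))
  have hδ : 0 < δ := by positivity
  have hcont : ContinuousAt φ z₀ := continuousAt_extChartAt z₀
  filter_upwards [Metric.continuousAt_iff'.1 hcont δ hδ,
    extChartAt_source_mem_nhds (I := 𝓘(ℝ, B)) z₀] with z hz hzs
  have hφz : φ.symm (φ z) = z := φ.left_inv hzs
  have hb := norm_le_of_homogeneous_of_bound
    (f := fun u x => P.trivPair e e' z u x - P.trivPair e e' z₀ u x) (r := r / 2)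
    (η := ε * (r / 2) ^ 2) (fun a c u x => by simp only [trivPair_smul_smul]; ring)
    (half_pos hr) ?_
  · intro u x
    have := hb u x
    rwa [mul_div_cancel_right₀ _ (by positivity)] at this
  intro u x hu hx
  have hux : max ‖u‖ ‖x‖ < r := (max_le hu hx).trans_lt (half_lt_self hr)
  have h1 : (φ z, u, x) ∈ t := hrt <| by
    rw [Metric.mem_ball, Prod.dist_eq, Prod.dist_eq, dist_zero_right, dist_zero_right]
    exact max_lt (hz.trans_le (min_le_left _ _)) hux
  have h2 : (v₀, u, x) ∈ t := hrt <| by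
    rw [Metric.mem_ball, Prod.dist_eq, Prod.dist_eq, dist_zero_right, dist_zero_right, dist_self]
    exact max_lt hr hux
  -- The two points share their vector components, so their distance is that of the base points
  -- alone.
  have h3 := hC.dist_le_mul _ h1 _ h2
  simp only [hφz, hφ₀, Prod.dist_eq, dist_self] at h3
  rw [dist_eq_norm] at h3
  refine h3.trans ?_
  rw [max_eq_left dist_nonneg]
  have h4 : dist (φ z) v₀ ≤ ε * (r / 2) ^ 2 / (C + 1) := hz.le.trans (min_le_right _ _)
  rw [le_div_iff₀ (by positivity)] at h4
  nlinarith [dist_nonneg (x := φ z) (y := v₀)]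

end LikeHermitianStructure

/-! ### Norm continuity of the kernel map and of its range -/

namespace ReproducingKernel

variable {P : LikeHermitianStructure B E D} (K : ReproducingKernel P)

/-- `K̂` on the fiber over `s`, read in a trivialization. -/
def trivHat (e : Trivialization E (π E D)) [MemTrivializationAtlas e] (s : Z) :
    E →L[ℂ] K.RKHS where
  toLinearMap := (K.hat s).comp (e.symmL ℂ s : E →ₗ[ℂ] D s)
  cont := by
    refine continuous_of_continuousAt_zero ((K.hat s).comp (e.symmL ℂ s : E →ₗ[ℂ] D s)) ?_
    have h := P.inv_inv s
    -- By the reproducing formula, $\|K_\xi\|^2=(K(s^{-*},s)\xi\mid\xi)$, which is continuous in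
    -- $\xi$.
    have hnorm : Continuous fun x : E => ‖K.hat s (e.symmL ℂ s x)‖ := by
      simp only [K.norm_hat h]
      have hx := (e.symmL ℂ s).continuous
      exact Real.continuous_sqrt.comp (RCLike.continuous_re.comp
        ((P.continuous_pair h).comp (((K.toFun (P.inv s) s).continuous.comp hx).prodMk hx)))
    rw [ContinuousAt, map_zero, tendsto_zero_iff_norm_tendsto_zero]
    simpa using hnorm.tendsto 0

theorem trivHat_apply (e : Trivialization E (π E D)) [MemTrivializationAtlas e] (s : Z) (x : E) :
    K.trivHat e s x = K.hat s (e.symmL ℂ s x) := rfl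

/-- The kernel read in two trivializations. -/
def trivKernel (e e' : Trivialization E (π E D)) [MemTrivializationAtlas e]
    [MemTrivializationAtlas e'] (s t : Z) : E →L[ℂ] E :=
  (e.continuousLinearMapAt ℂ s).comp ((K.toFun s t).comp (e'.symmL ℂ t))

/-- Separates the Gram kernel into its two sources of variation: the pairing over $s^{-*}$ and the
kernel as an operator on the typical fiber. -/
theorem inner_trivHat (e e' : Trivialization E (π E D)) [MemTrivializationAtlas e]
    [MemTrivializationAtlas e'] {s : Z} (hs : P.inv s ∈ e'.baseSet) (t : Z) (x y : E) :
    inner ℂ (K.trivHat e s x) (K.trivHat e t y) =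
      P.trivPair e' e (P.inv s) (K.trivKernel e' e (P.inv s) t y) x := by
  rw [trivHat_apply, trivHat_apply, K.inner_hat (P.inv_inv s), ← P.pair_symmL e' e (P.inv_inv s)]
  congr 2
  exact (e'.symmL_continuousLinearMapAt hs _).symm

theorem eventually_inner_trivHat_sub_le [IsManifold 𝓘(ℝ, B) ∞ Z] (hK : K.IsContinuous)
    (e e' : Trivialization E (π E D)) [MemTrivializationAtlas e] [MemTrivializationAtlas e']
    {s₀ : Z} (hs₀ : s₀ ∈ e.baseSet) (hs₀' : P.inv s₀ ∈ e'.baseSet) {ε : ℝ} (hε : 0 < ε) :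
    ∀ᶠ p : Z × Z in 𝓝 (s₀, s₀), ∀ x y,
      ‖(inner ℂ (K.trivHat e p.1 x) (K.trivHat e p.2 y) : ℂ) -
        inner ℂ (K.trivHat e s₀ x) (K.trivHat e s₀ y)‖ ≤ ε * ‖x‖ * ‖y‖ := by
  obtain ⟨C, hC0, hC⟩ := P.exists_trivPair_le e' e (P.inv s₀)
  have hinv : ContinuousAt (fun p : Z × Z => P.inv p.1) (s₀, s₀) :=
    (P.inv.continuous.comp continuous_fst).continuousAt
  have hM : ContinuousAt (fun p : Z × Z => K.trivKernel e' e (P.inv p.1) p.2) (s₀, s₀) := by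
    have h1 : ContinuousAt (fun p : Z × Z => K.trivKernel e' e p.1 p.2) (P.inv s₀, s₀) :=
      (hK e' e).continuousAt
        ((e'.open_baseSet.prod e.open_baseSet).mem_nhds ⟨hs₀', hs₀⟩)
    exact ContinuousAt.comp (g := fun p : Z × Z => K.trivKernel e' e p.1 p.2)
      (f := fun p : Z × Z => (P.inv p.1, p.2)) h1 (hinv.prodMk continuousAt_snd)
  set M₀ := K.trivKernel e' e (P.inv s₀) s₀
  -- The error splits in two: `δ` controls the change of the kernel under the fixed pairing, and
  -- `δ'` the change of the pairing on $My$ with $\|M\|\le\|M_0\|+1$. Each part contributes at most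
  -- $\varepsilon/2$.
  let δ := min 1 (ε / (2 * (C + 1)))
  have hδ : 0 < δ := by positivity
  let δ' := ε / (2 * (‖M₀‖ + 1))
  have hδ' : 0 < δ' := by positivity
  have hpair := P.eventually_trivPair_sub_le e' e hs₀' (by rwa [P.inv_inv]) hδ'
  filter_upwards [Metric.continuousAt_iff'.1 hM δ hδ, hinv.eventually hpair,
    hinv.eventually (e'.open_baseSet.mem_nhds hs₀')] with p hpM hpp hpe x y
  rw [K.inner_trivHat e e' hpe, K.inner_trivHat e e' hs₀']
  set M := K.trivKernel e' e (P.inv p.1) p.2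
  have hpM' : ‖M - M₀‖ ≤ δ := by rw [← dist_eq_norm]; exact hpM.le
  have hMn : ‖M‖ ≤ ‖M₀‖ + 1 := by
    have h1 : δ ≤ 1 := min_le_left _ _
    linarith [norm_sub_norm_le M M₀]
  have hsplit : P.trivPair e' e (P.inv p.1) (M y) x - P.trivPair e' e (P.inv s₀) (M₀ y) x =
      (P.trivPair e' e (P.inv p.1) (M y) x - P.trivPair e' e (P.inv s₀) (M y) x) +
        P.trivPair e' e (P.inv s₀) ((M - M₀) y) x := by
    rw [sub_apply, P.trivPair_sub_left]
    ring
  have hb1 : δ' * (‖M₀‖ + 1) = ε / 2 := by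
    simp only [δ']
    field_simp
  have hb2 : C * δ ≤ ε / 2 := by
    have h1 : δ * (2 * (C + 1)) ≤ ε := (le_div_iff₀ (by positivity)).1 (min_le_right _ _)
    nlinarith
  calc _ ≤ δ' * ‖M y‖ * ‖x‖ + C * ‖(M - M₀) y‖ * ‖x‖ := by
        rw [hsplit]
        exact (norm_add_le _ _).trans (add_le_add (hpp _ _) (hC _ _))
    _ ≤ δ' * ((‖M₀‖ + 1) * ‖y‖) * ‖x‖ + C * (δ * ‖y‖) * ‖x‖ := by
        have h1 := M.le_of_opNorm_le hMn y
        have h2 := (M - M₀).le_of_opNorm_le hpM' y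
        gcongr
    _ = (δ' * (‖M₀‖ + 1) + C * δ) * (‖x‖ * ‖y‖) := by ring
    _ ≤ ε * (‖x‖ * ‖y‖) := by
        gcongr
        linarith
    _ = ε * ‖x‖ * ‖y‖ := by ring

theorem continuousAt_trivHat [IsManifold 𝓘(ℝ, B) ∞ Z] (hK : K.IsContinuous)
    (e : Trivialization E (π E D)) [MemTrivializationAtlas e] {s₀ : Z} (hs₀ : s₀ ∈ e.baseSet) :
    ContinuousAt (K.trivHat e) s₀ :=
  continuousAt_of_eventually_inner_sub_le fun _ hε =>
    K.eventually_inner_trivHat_sub_le hK e (trivializationAt E D (P.inv s₀)) hs₀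
      (mem_baseSet_trivializationAt E D (P.inv s₀)) hε

theorem range_trivHat (e : Trivialization E (π E D)) [MemTrivializationAtlas e] {s : Z}
    (hs : s ∈ e.baseSet) : Set.range (K.trivHat e s) = Set.range (K.hat s) := by
  refine (Function.Surjective.range_comp (f := e.symmL ℂ s) (fun ξ => ?_) (K.hat s))
  exact ⟨_, e.symmL_continuousLinearMapAt hs ξ⟩

theorem trivHat_injective (e : Trivialization E (π E D)) [MemTrivializationAtlas e] {s : Z}
    (hs : s ∈ e.baseSet) (hinj : Function.Injective (K.hat s)) :
    Function.Injective (K.trivHat e s) :=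
  hinj.comp (Function.LeftInverse.injective
    (g := e.continuousLinearMapAt ℂ s) fun x => e.continuousLinearMapAt_symmL hs x)

theorem continuous_zeta [IsManifold 𝓘(ℝ, B) ∞ Z] [CompleteSpace E] (hK : K.IsContinuous)
    (hinj : ∀ s, Function.Injective (K.hat s))
    (hclosed : ∀ s, IsClosed (Set.range (K.hat s))) : Continuous K.zeta := by
  rw [continuous_iff_continuousAt]
  intro s₀
  let e := trivializationAt E D s₀
  have hs₀ : s₀ ∈ e.baseSet := mem_baseSet_trivializationAt E D s₀
  -- An injective operator with closed range between Banach spaces is bounded below, by the open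
  -- mapping theorem.
  obtain ⟨C, hC⟩ := (K.trivHat e s₀).antilipschitz_of_injective_of_isClosed_range
    (K.trivHat_injective e hs₀ (hinj s₀)) (by rw [K.range_trivHat e hs₀]; exact hclosed s₀)
  refine Grassmannian.continuousAt_of_range (K.continuousAt_trivHat hK e hs₀) ?_
    -- The antilipschitz constant `C` may be zero, so $C+1$ is inverted instead.
    (c := 1 / (C + 1)) (by positivity) fun v => ?_
  · filter_upwards [e.open_baseSet.mem_nhds hs₀] with s hs
    rw [K.carrier_zeta (hclosed s), K.range_trivHat e hs]
  · have h := hC.le_mul_dist v 0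
    rw [map_zero, dist_zero_right, dist_zero_right] at h
    rw [one_div, inv_mul_le_iff₀ (by positivity)]
    nlinarith [norm_nonneg (K.trivHat e s₀ v)]

end ReproducingKernel

end Bundle

end

theorem theorem5p5 {Z B E : Type*} {D : Z → Type*}
    -- `Z` is a real Banach manifold modelled on `B`
    [NormedAddCommGroup B] [NormedSpace ℝ B] [CompleteSpace B]
    [TopologicalSpace Z] [ChartedSpace B Z] [IsManifold 𝓘(ℝ, B) ∞ Z]
    -- `D` is a smooth vector bundle over `Z` with typical fiber the complex Banach space `E`
    [NormedAddCommGroup E] [NormedSpace ℂ E] [CompleteSpace E]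
    [∀ z, AddCommGroup (D z)] [∀ z, Module ℂ (D z)] [∀ z, TopologicalSpace (D z)]
    [TopologicalSpace (TotalSpace E D)] [FiberBundle E D] [VectorBundle ℂ E D]
    [ContMDiffVectorBundle ∞ E D 𝓘(ℝ, B)]
    (P : LikeHermitianStructure B E D) (K : ReproducingKernel P)
    (hK : K.IsContinuous)
    (hinj : ∀ s, Function.Injective (K.hat s))
    (hclosed : ∀ s, IsClosed (Set.range (K.hat s))) :
    Continuous K.zeta ↔ Grassmannian.IsLocallySimilar K.zeta := by
  exact ⟨Grassmannian.isLocallySimilar_of_continuous,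
    fun _ => K.continuous_zeta hK hinj hclosed⟩
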